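/- Let $d\ge 1$ and let $P\subset\mathbb{R}^d$ be a space-filling zonotope of dimension $d$: that is, $P$ is a $d$-dimensional polytope which is a translate of a Minkowski sum of finitely many segments $[\mathbf 0,\mathbf v_i]$, $\mathbf v_1,\dots,\mathbf v_n\in\mathbb{R}^d$, and $\mathbb{R}^d$ can be tiled by translates of $P$ (some family of translates of $P$ covers $\mathbb{R}^d$ and has pairwise disjoint interiors). Then the belt diameter of $P$ is at most $\lceil\log_2 d\rceil$. Here a facet (ridge) of $P$ is a face of codimension $1$ (codimension $2$), and the belt of $P$ corresponding to a ridge $R$ is the set of all facets of $P$ that are parallel to $R$. A belt path of length $n$ from a facet $F$ to a facet $G$ is a sequence $F=F_0,\mathcal B_1,F_1,\mathcal B_2,\dots,\mathcal B_n,F_n=G$ in which every $F_i$ is a facet of $P$ and every $\mathcal B_i$ is a belt of $P$ containing both $F_{i-1}$ and $F_i$. The belt distance between $F$ and $G$ is $0$ if $F$ and $G$ are opposite (exchanged by the central symmetry of $P$), and otherwise the smallest length of a belt path from $F$ to $G$ ($\infty$ if there is none). The belt diameter of $P$ is the largest belt distance between two facets of $P$. -/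

import Mathlib

open scoped Pointwise

namespace SpaceFilling

variable {E : Type*} [NormedAddCommGroup E] [NormedSpace ℝ E]

/-- The zonotope `Z(v₁, …, vₙ)`: the Minkowski sum of the segments `[0, vᵢ]`
(the origin if `n = 0`). -/
def zonotope {n : ℕ} (v : Fin n → E) : Set E :=
  ∑ i, segment ℝ 0 (v i)

/-- A zonotope: a translate of a Minkowski sum of finitely many segments. -/
def IsZonotope (P : Set E) : Prop :=
  ∃ (n : ℕ) (v : Fin n → E) (c : E), P = c +ᵥ zonotope v

/-- A convex polytope: the convex hull of a nonempty finite set of points. -/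
def IsPolytope (P : Set E) : Prop :=
  ∃ s : Set E, s.Finite ∧ s.Nonempty ∧ P = convexHull ℝ s

/-- `P` tiles the space by translates: for some set `T` of translation vectors the sets `t + P`,
`t ∈ T`, cover the space and have pairwise disjoint interiors. The tiling is not required to be
face-to-face or a lattice tiling. -/
def TilesByTranslates (P : Set E) : Prop :=
  ∃ T : Set E, (⋃ t ∈ T, (t +ᵥ P)) = Set.univ ∧
    T.PairwiseDisjoint fun t => interior (t +ᵥ P)

/-- A parallelohedron: a full-dimensional polytope that tiles the space by translates. -/
structure IsParallelohedron (P : Set E) : Prop where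
  isPolytope : IsPolytope P
  interior_nonempty : (interior P).Nonempty
  tiles : TilesByTranslates P

/-- The dimension of a set: the dimension of its affine hull. -/
noncomputable def dim (A : Set E) : ℕ :=
  Module.finrank ℝ (vectorSpan ℝ A)

/-- A nonempty face of `P`: the set of all points of `P` at which some linear functional attains
its maximum over `P`. -/
def IsFace (P F : Set E) : Prop :=
  F.Nonempty ∧ IsExposed ℝ P F

/-- A facet: a face of codimension one. -/
def IsFacet (P F : Set E) : Prop :=
  IsFace P F ∧ dim F + 1 = dim P

/-- A ridge: a face of codimension two. -/
def IsRidge (P R : Set E) : Prop :=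
  IsFace P R ∧ dim R + 2 = dim P

/-- The belt of `P` corresponding to the ridge `R`: the set of all facets of `P` parallel
to `R`. -/
def belt (P R : Set E) : Set (Set E) :=
  {F | IsFacet P F ∧ vectorSpan ℝ R ≤ vectorSpan ℝ F}

/-- `F₀, B₁, F₁, B₂, …, Bₙ, Fₙ` is a belt path on `P`: the `Fᵢ` are facets of `P`, and each `Bᵢ`
is a belt of `P` that contains `Fᵢ₋₁` and `Fᵢ`. -/
structure IsBeltPath (P : Set E) (n : ℕ) (F : Fin (n + 1) → Set E)
    (B : Fin n → Set (Set E)) : Prop where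
  isFacet : ∀ i, IsFacet P (F i)
  isBelt : ∀ i, ∃ R, IsRidge P R ∧ B i = belt P R
  left_mem : ∀ i, F i.castSucc ∈ B i
  right_mem : ∀ i, F i.succ ∈ B i

/-- There is a belt path on `P` with `n` belts from `F` to `G`. -/
def ExistsBeltPath (P F G : Set E) (n : ℕ) : Prop :=
  ∃ (A : Fin (n + 1) → Set E) (B : Fin n → Set (Set E)),
    IsBeltPath P n A B ∧ A 0 = F ∧ A (Fin.last n) = G

/-- `F` and `G` are opposite in `P`: they are exchanged by a central symmetry of `P`. -/
def AreOpposite (P F G : Set E) : Prop :=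
  ∃ c : E, Equiv.pointReflection c '' P = P ∧ Equiv.pointReflection c '' F = G

open Classical in
/-- The belt distance between two facets: `0` if they are opposite, and otherwise the smallest
number of belts in a belt path that joins them (`⊤` if there is none). -/
noncomputable def beltDist (P F G : Set E) : ℕ∞ :=
  if AreOpposite P F G then 0 else ⨅ (n : ℕ) (_ : ExistsBeltPath P F G n), (n : ℕ∞)

/-- The belt diameter of `P`: the largest belt distance between two facets of `P`. -/
noncomputable def beltDiameter (P : Set E) : ℕ∞ :=
  ⨆ (F : Set E) (_ : IsFacet P F) (G : Set E) (_ : IsFacet P G), beltDist P F G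

end SpaceFilling

open scoped Pointwise

namespace SpaceFilling

/-! ### Faces of zonotopes: weights, directions, opposite facets. -/

section Zonotope

variable {E : Type*} [NormedAddCommGroup E] [NormedSpace ℝ E] {n : ℕ} {v : Fin n → E} {c : E}

/-! The directions of the facets of a zonotope are the hyperplanes spanned by generators, and
parallel facets are equal or opposite. Spanned subspaces of codimension two are directions of
ridges. So a belt path is a walk among spanned hyperplanes in which consecutive ones share such a
subspace `L`.

The tiling enters only through `belt_card_le_three`: at most three spanned hyperplanes pass through
`L`. Four of them would yield four functionals that vanish on `L`, but on no generator outside it,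
with pairwise incomparable sign vectors. At a generic point of a ridge parallel to `L` at least
three tiles meet. Over each tile at most one of the four functionals is extremal at that point, so
some `φ` is extremal for none of three tiles. The line `ker φ / L` then enters the interior of each
of them along one of its two directions, and two tiles overlap.

Now let `H`, `K` be distinct spanned hyperplanes, `M` the span of the generators in `H ∩ K`, and `L
⊇ M` a spanned subspace of codimension one in `H`. Generators in `K` outside `L` avoid `H`, so they
lie on at most two further hyperplanes `A`, `B` through `L`. Hence `K` is the sum of the spans of
the generators in `A ∩ K` and in `B ∩ K`, both of which contain `M`. Counting dimensions, one of
them has at most about half the codimension of `M` (`exists_hyperplane_halving`). Moving to that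
hyperplane costs one belt. If `d ≤ 2 ^ k`, then after at most `k` halvings the codimension is 1 and
the direction `K` is reached. -/

theorem mem_zonotope {y : E} :
    y ∈ zonotope v ↔ ∃ w : Fin n → ℝ, (∀ i, 0 ≤ w i ∧ w i ≤ 1) ∧ y = ∑ i, w i • v i := by
  unfold zonotope
  rw [Set.mem_finsetSum]
  constructor
  · rintro ⟨g, hg, rfl⟩
    have h : ∀ i, ∃ θ : ℝ, (0 ≤ θ ∧ θ ≤ 1) ∧ g i = θ • v i := by
      intro i
      have := hg (Finset.mem_univ i)
      rw [segment_eq_image] at this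
      obtain ⟨θ, hθ, h⟩ := this
      exact ⟨θ, hθ, by simp [← h]⟩
    choose w hw h using h
    exact ⟨w, hw, Finset.sum_congr rfl fun i _ => h i⟩
  · rintro ⟨w, hw, rfl⟩
    refine ⟨fun i => w i • v i, fun {i} _ => ?_, rfl⟩
    rw [segment_eq_image]
    exact ⟨w i, hw i, by simp⟩

theorem mem_vadd_zonotope {y : E} :
    y ∈ c +ᵥ zonotope v ↔
      ∃ w : Fin n → ℝ, (∀ i, 0 ≤ w i ∧ w i ≤ 1) ∧ y = c + ∑ i, w i • v i := by
  rw [Set.mem_vadd_set]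
  constructor
  · rintro ⟨z, hz, rfl⟩
    obtain ⟨w, hw, rfl⟩ := mem_zonotope.1 hz
    exact ⟨w, hw, rfl⟩
  · rintro ⟨w, hw, rfl⟩
    exact ⟨_, mem_zonotope.2 ⟨w, hw, rfl⟩, rfl⟩

theorem vadd_zonotope_eq_image :
    c +ᵥ zonotope v = (fun w : Fin n → ℝ => c + ∑ i, w i • v i) '' Set.Icc 0 1 := by
  ext y
  rw [mem_vadd_zonotope]
  constructor
  · rintro ⟨w, hw, rfl⟩
    exact ⟨w, ⟨fun i => (hw i).1, fun i => (hw i).2⟩, rfl⟩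
  · rintro ⟨w, hw, rfl⟩
    exact ⟨w, fun i => ⟨hw.1 i, hw.2 i⟩, rfl⟩

theorem isCompact_vadd_zonotope : IsCompact (c +ᵥ zonotope v) := by
  rw [vadd_zonotope_eq_image]
  exact isCompact_Icc.image (by fun_prop)

theorem convex_vadd_zonotope : Convex ℝ (c +ᵥ zonotope v) := by
  apply Convex.vadd
  exact convex_sum _ fun i _ => convex_segment _ _

/-- A point of a zonotope maximises a functional over the zonotope if and only if its coefficients
are extreme in accordance with the signs of the functional on the generators. -/
theorem forall_le_iff_of_weights (l : E →ₗ[ℝ] ℝ) {w : Fin n → ℝ}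
    (hw : ∀ i, 0 ≤ w i ∧ w i ≤ 1) :
    (∀ z ∈ c +ᵥ zonotope v, l z ≤ l (c + ∑ i, w i • v i)) ↔
      ∀ i, (0 < l (v i) → w i = 1) ∧ (l (v i) < 0 → w i = 0) := by
  constructor
  · intro h i
    -- Replacing the single coefficient `w i` by `r` changes the value of `l` by exactly this
    -- product.
    have key : ∀ r : ℝ, 0 ≤ r → r ≤ 1 → (r - w i) * l (v i) ≤ 0 := by
      intro r h0 h1
      have := h _ (mem_vadd_zonotope.2 ⟨Function.update w i r, fun j => ?_, rfl⟩)
      · have e : ∑ j, Function.update w i r j • v j = ∑ j, w j • v j + (r - w i) • v i := by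
          rw [← sub_eq_iff_eq_add', ← Finset.sum_sub_distrib, Finset.sum_eq_single i]
          · simp [sub_smul]
          · intro j _ hj
            simp [Function.update_of_ne hj]
          · simp
        rw [e] at this
        simp only [map_add, map_smul, smul_eq_mul] at this
        linarith
      · by_cases hj : j = i
        · subst hj; simp [h0, h1]
        · simpa [Function.update_of_ne hj] using hw j
    constructor
    · intro hp
      have := key 1 zero_le_one le_rfl
      have h2 := (hw i).2
      nlinarith
    · intro hp
      have := key 0 le_rfl zero_le_one
      have h2 := (hw i).1
      nlinarith
  · intro h z hz
    obtain ⟨u, hu, rfl⟩ := mem_vadd_zonotope.1 hz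
    simp only [map_add, map_sum, map_smul, smul_eq_mul]
    refine add_le_add_right (Finset.sum_le_sum fun i _ => ?_) _
    rcases lt_trichotomy (l (v i)) 0 with h1 | h1 | h1
    · rw [(h i).2 h1]
      nlinarith [(hu i).1]
    · simp [h1]
    · rw [(h i).1 h1]
      nlinarith [(hu i).2]

/-- The face of a set at which a functional is maximal. -/
def maxFace (P : Set E) (l : E →ₗ[ℝ] ℝ) : Set E :=
  {x | x ∈ P ∧ ∀ y ∈ P, l y ≤ l x}

/-- The submodule spanned by those vectors of a family that lie in a given submodule. -/
def flat (v : Fin n → E) (H : Submodule ℝ E) : Submodule ℝ E :=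
  Submodule.span ℝ {x | x ∈ H ∧ ∃ i, v i = x}

theorem flat_le (H : Submodule ℝ E) : flat v H ≤ H :=
  Submodule.span_le.2 fun _ hx => hx.1

theorem mem_flat {H : Submodule ℝ E} {i : Fin n} (h : v i ∈ H) : v i ∈ flat v H :=
  Submodule.subset_span ⟨h, i, rfl⟩

theorem flat_mono {H K : Submodule ℝ E} (h : H ≤ K) : flat v H ≤ flat v K :=
  Submodule.span_mono fun _ hx => ⟨h hx.1, hx.2⟩

theorem flat_le_iff {H K : Submodule ℝ E} : flat v H ≤ K ↔ ∀ i, v i ∈ H → v i ∈ K := by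
  rw [flat, Submodule.span_le]
  constructor
  · intro h i hi
    exact h ⟨hi, i, rfl⟩
  · rintro h _ ⟨hx, i, rfl⟩
    exact h i hx

theorem flat_flat (H : Submodule ℝ E) : flat v (flat v H) = flat v H :=
  le_antisymm (flat_le _) (flat_le_iff.2 fun _ hi => mem_flat (mem_flat hi))

open Classical in
/-- The barycentric coefficients of a maximal face. -/
noncomputable def faceWeight (v : Fin n → E) (l : E →ₗ[ℝ] ℝ) (i : Fin n) : ℝ :=
  if 0 < l (v i) then 1 else if l (v i) < 0 then 0 else 1 / 2

theorem faceWeight_mem (l : E →ₗ[ℝ] ℝ) (i : Fin n) :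
    0 ≤ faceWeight v l i ∧ faceWeight v l i ≤ 1 := by
  unfold faceWeight
  split_ifs <;> norm_num

theorem mem_maxFace_iff {l : E →ₗ[ℝ] ℝ} {y : E} :
    y ∈ maxFace (c +ᵥ zonotope v) l ↔
      ∃ w : Fin n → ℝ, (∀ i, 0 ≤ w i ∧ w i ≤ 1) ∧
        (∀ i, (0 < l (v i) → w i = 1) ∧ (l (v i) < 0 → w i = 0)) ∧ y = c + ∑ i, w i • v i := by
  constructor
  · rintro ⟨hy, hmax⟩
    obtain ⟨w, hw, rfl⟩ := mem_vadd_zonotope.1 hy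
    exact ⟨w, hw, (forall_le_iff_of_weights l hw).1 hmax, rfl⟩
  · rintro ⟨w, hw, h, rfl⟩
    exact ⟨mem_vadd_zonotope.2 ⟨w, hw, rfl⟩, (forall_le_iff_of_weights l hw).2 h⟩

theorem faceWeight_mem_maxFace (l : E →ₗ[ℝ] ℝ) :
    c + ∑ i, faceWeight v l i • v i ∈ maxFace (c +ᵥ zonotope v) l := by
  refine mem_maxFace_iff.2 ⟨_, faceWeight_mem l, fun i => ⟨fun h => ?_, fun h => ?_⟩, rfl⟩
  · simp [faceWeight, h]
  · simp [faceWeight, h, h.le.not_gt]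

/-- On the face only the coefficients of generators in `ker l` are free; the others are forced to 0
or 1. This translates faces into subspaces spanned by generators. -/
theorem vectorSpan_maxFace (l : E →ₗ[ℝ] ℝ) :
    vectorSpan ℝ (maxFace (c +ᵥ zonotope v) l) = flat v (LinearMap.ker l) := by
  apply le_antisymm
  · rw [vectorSpan_def, Submodule.span_le]
    rintro _ ⟨x, hx, y, hy, rfl⟩
    obtain ⟨w, hw, hwl, rfl⟩ := mem_maxFace_iff.1 hx
    obtain ⟨u, hu, hul, rfl⟩ := mem_maxFace_iff.1 hy
    simp only [vsub_eq_sub, add_sub_add_left_eq_sub, ← Finset.sum_sub_distrib, ← sub_smul]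
    refine Submodule.sum_mem _ fun i _ => ?_
    rcases lt_trichotomy (l (v i)) 0 with h | h | h
    · simp [(hwl i).2 h, (hul i).2 h]
    · exact Submodule.smul_mem _ _ (mem_flat h)
    · simp [(hwl i).1 h, (hul i).1 h]
  · rw [flat_le_iff]
    intro i hi
    have hi : l (v i) = 0 := hi
    set w := faceWeight v l
    have h1 := faceWeight_mem_maxFace (c := c) (v := v) l
    have h2 : c + ∑ j, Function.update w i 1 j • v j ∈ maxFace (c +ᵥ zonotope v) l := by
      refine mem_maxFace_iff.2 ⟨_, fun j => ?_, fun j => ?_, rfl⟩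
      · by_cases hj : j = i
        · subst hj; simp
        · simpa [Function.update_of_ne hj] using faceWeight_mem l j
      · by_cases hj : j = i
        · subst hj; simp [hi]
        · rw [Function.update_of_ne hj]
          exact ⟨fun h => by simp [w, faceWeight, h],
            fun h => by simp [w, faceWeight, h, not_lt_of_gt h]⟩
    have h3 := vsub_mem_vectorSpan ℝ h2 h1
    have e : ∑ j, Function.update w i 1 j • v j - ∑ j, w j • v j = (1 / 2 : ℝ) • v i := by
      rw [← Finset.sum_sub_distrib, Finset.sum_eq_single i]
      · rw [← sub_smul]
        have : w i = 1 / 2 := by simp [w, faceWeight, hi]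
        simp [this]; norm_num
      · intro j _ hj
        simp [Function.update_of_ne hj]
      · simp
    rw [vsub_eq_sub, add_sub_add_left_eq_sub, e] at h3
    exact (Submodule.smul_mem_iff _ (by norm_num)).1 h3

/-- The maximal face of a multiple of a functional. -/
theorem maxFace_smul {P : Set E} {a : ℝ} (ha : 0 < a) (l : E →ₗ[ℝ] ℝ) :
    maxFace P (a • l) = maxFace P l := by
  ext x
  simp [maxFace, ha]

/-- The central symmetry of a zonotope exchanges the maximal faces of opposite functionals. -/
theorem areOpposite_maxFace_neg (l : E →ₗ[ℝ] ℝ) :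
    AreOpposite (c +ᵥ zonotope v) (maxFace (c +ᵥ zonotope v) l)
      (maxFace (c +ᵥ zonotope v) (-l)) := by
  set P := c +ᵥ zonotope v with hP
  -- The centre of the zonotope: reflection in it replaces each coefficient `w i` by `1 - w i`.
  set m := c + (1 / 2 : ℝ) • ∑ i, v i with hm
  have hinv : ∀ x, Equiv.pointReflection m (Equiv.pointReflection m x) = x := fun x =>
    Equiv.pointReflection_involutive m x
  have hmem : ∀ x ∈ P, Equiv.pointReflection m x ∈ P := by
    intro x hx
    obtain ⟨w, hw, rfl⟩ := mem_vadd_zonotope.1 hx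
    refine mem_vadd_zonotope.2 ⟨fun i => 1 - w i, fun i => ⟨?_, ?_⟩, ?_⟩
    · linarith [(hw i).2]
    · linarith [(hw i).1]
    · rw [Equiv.pointReflection_apply]
      simp only [vsub_eq_sub, vadd_eq_add, sub_smul, one_smul, Finset.sum_sub_distrib, hm]
      module
  have himg : ∀ A B : Set E, (∀ x ∈ A, Equiv.pointReflection m x ∈ B) →
      (∀ x ∈ B, Equiv.pointReflection m x ∈ A) → Equiv.pointReflection m '' A = B := by
    intro A B h1 h2
    apply Set.Subset.antisymm
    · rintro _ ⟨x, hx, rfl⟩; exact h1 x hx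
    · intro x hx; exact ⟨_, h2 x hx, hinv x⟩
  have hl : ∀ x, l (Equiv.pointReflection m x) = 2 * l m - l x := by
    intro x
    rw [Equiv.pointReflection_apply]
    simp only [vsub_eq_sub, vadd_eq_add, map_add, map_sub]
    ring
  refine ⟨m, himg _ _ hmem hmem, himg _ _ ?_ ?_⟩
  · rintro x ⟨hx, h⟩
    refine ⟨hmem x hx, fun y hy => ?_⟩
    have := h _ (hmem y hy)
    simp only [LinearMap.neg_apply, hl] at this ⊢
    linarith
  · rintro x ⟨hx, h⟩
    refine ⟨hmem x hx, fun y hy => ?_⟩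
    have := h _ (hmem y hy)
    simp only [LinearMap.neg_apply, hl] at this ⊢
    linarith

variable [FiniteDimensional ℝ E]

theorem isFace_iff {P F : Set E} :
    IsFace P F ↔ F.Nonempty ∧ ∃ l : E →ₗ[ℝ] ℝ, F = maxFace P l := by
  constructor
  · rintro ⟨h, h'⟩
    obtain ⟨l, hl⟩ := h' h
    exact ⟨h, l, hl⟩
  · rintro ⟨h, l, hl⟩
    exact ⟨h, fun _ => ⟨LinearMap.toContinuousLinearMap l, hl⟩⟩

theorem isFace_maxFace (l : E →ₗ[ℝ] ℝ) :
    IsFace (c +ᵥ zonotope v) (maxFace (c +ᵥ zonotope v) l) :=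
  isFace_iff.2 ⟨⟨_, faceWeight_mem_maxFace l⟩, l, rfl⟩

omit [FiniteDimensional ℝ E] in
theorem dim_of_interior_nonempty {P : Set E} (h : (interior P).Nonempty) :
    dim P = Module.finrank ℝ E := by
  have : affineSpan ℝ P = ⊤ := by
    apply top_unique
    rw [← isOpen_interior.affineSpan_eq_top h]
    exact affineSpan_mono ℝ interior_subset
  rw [dim, ← direction_affineSpan, this, AffineSubspace.direction_top, finrank_top]

/-- The facets of a full-dimensional zonotope are the maximal faces of the nonzero functionals whose
kernels are spanned by generators. -/
theorem isFacet_iff {F : Set E} (hint : (interior (c +ᵥ zonotope v)).Nonempty) :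
    IsFacet (c +ᵥ zonotope v) F ↔
      ∃ l : E →ₗ[ℝ] ℝ, l ≠ 0 ∧ F = maxFace (c +ᵥ zonotope v) l ∧
        flat v (LinearMap.ker l) = LinearMap.ker l := by
  rw [IsFacet, dim_of_interior_nonempty hint]
  constructor
  · rintro ⟨hF, hdim⟩
    obtain ⟨-, l, rfl⟩ := isFace_iff.1 hF
    have hl : l ≠ 0 := by
      rintro rfl
      have : maxFace (c +ᵥ zonotope v) (0 : E →ₗ[ℝ] ℝ) = c +ᵥ zonotope v := by
        ext; simp [maxFace]
      rw [this, dim_of_interior_nonempty hint] at hdim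
      omega
    refine ⟨l, hl, rfl, Submodule.eq_of_le_of_finrank_eq (flat_le _) ?_⟩
    rw [dim, vectorSpan_maxFace] at hdim
    have := Module.Dual.finrank_ker_add_one_of_ne_zero (f := l) hl
    omega
  · rintro ⟨l, hl, rfl, h⟩
    refine ⟨isFace_maxFace l, ?_⟩
    rw [dim, vectorSpan_maxFace, h]
    exact Module.Dual.finrank_ker_add_one_of_ne_zero (f := l) hl

/-- Parallel facets of a zonotope are equal or opposite. -/
theorem eq_or_areOpposite {F G : Set E} (hint : (interior (c +ᵥ zonotope v)).Nonempty)
    (hF : IsFacet (c +ᵥ zonotope v) F) (hG : IsFacet (c +ᵥ zonotope v) G)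
    (h : vectorSpan ℝ F = vectorSpan ℝ G) :
    F = G ∨ AreOpposite (c +ᵥ zonotope v) F G := by
  obtain ⟨f, hf, rfl, hfk⟩ := (isFacet_iff hint).1 hF
  obtain ⟨g, hg, rfl, hgk⟩ := (isFacet_iff hint).1 hG
  rw [vectorSpan_maxFace, vectorSpan_maxFace, hfk, hgk] at h
  obtain ⟨a, rfl⟩ : ∃ a : ℝ, a • f = g := by
    obtain ⟨u, hu⟩ : ∃ u, f u ≠ 0 := by
      by_contra! H
      exact hf (LinearMap.ext H)
    refine ⟨g u / f u, LinearMap.ext fun x => ?_⟩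
    have : x - (f x / f u) • u ∈ LinearMap.ker g := by
      rw [← h]
      simp [hu]
    have h2 : g x - f x / f u * g u = 0 := by simpa using this
    simp only [LinearMap.smul_apply, smul_eq_mul]
    rw [sub_eq_zero.1 h2]
    ring
  rcases lt_trichotomy a 0 with ha | rfl | ha
  · right
    have := areOpposite_maxFace_neg (c := c) (v := v) f
    rwa [← maxFace_smul (neg_pos.2 ha) (-f), smul_neg, neg_smul, neg_neg] at this
  · simp at hg
  · left
    rw [maxFace_smul ha]

end Zonotope

/-! ### Local structure of a tiling by translates of a convex body. -/

section Tiling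

variable {E : Type*} [NormedAddCommGroup E] [NormedSpace ℝ E] [FiniteDimensional ℝ E]
  {P : Set E} {T : Set E}

/-- Translates of a bounded set with pairwise disjoint nonempty interiors are locally finite. -/
theorem finite_setOf_tiles_meeting_closedBall (hint : (interior P).Nonempty)
    (hb : Bornology.IsBounded P) (hT : T.PairwiseDisjoint fun t => interior (t +ᵥ P)) (x : E) :
    {t ∈ T | ((t +ᵥ P) ∩ Metric.closedBall x 1).Nonempty}.Finite := by
  have : ProperSpace E := FiniteDimensional.proper_real E
  by_contra hinf
  obtain ⟨M, hM⟩ := hb.subset_closedBall 0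
  obtain ⟨p, hp⟩ := hint
  obtain ⟨r, hr, hpr⟩ := Metric.isOpen_iff.1 isOpen_interior p hp
  obtain ⟨a, -, ha⟩ := Set.Infinite.exists_accPt_of_subset_isCompact hinf
    (isCompact_closedBall (0 : E) (‖x‖ + 1 + M)) (by
      rintro t ⟨-, z, hz, hzx⟩
      rw [Set.mem_vadd_set] at hz
      obtain ⟨y, hy, rfl⟩ := hz
      have h1 := hM hy
      rw [mem_closedBall_zero_iff] at h1 ⊢
      rw [mem_closedBall_iff_norm, vadd_eq_add] at hzx
      calc ‖t‖ = ‖(t + y - x) + x - y‖ := by congr 1; abel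
        _ ≤ ‖t + y - x‖ + ‖x‖ + ‖y‖ := (norm_sub_le _ _).trans (by gcongr; exact norm_add_le _ _)
        _ ≤ ‖x‖ + 1 + M := by linarith)
  rw [accPt_iff_nhds] at ha
  obtain ⟨y, ⟨hya, hyT, -⟩, hy⟩ := ha _ (Metric.ball_mem_nhds a (half_pos hr))
  -- Taking the radius equal to the distance from `y` to `a` forces `z ≠ y`, while both remain
  -- within `r / 2` of `a`.
  obtain ⟨z, ⟨hza, hzT, -⟩, hz⟩ := ha _ (Metric.ball_mem_nhds a (dist_pos.2 hy))
  have hyz : y ≠ z := by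
    rintro rfl
    simp at hza
  have hdist : dist z y < r := by
    have := dist_triangle_right z y a
    rw [Metric.mem_ball] at hya hza
    linarith
  have hdisj := hT hyT hzT hyz
  simp only [Function.onFun, interior_vadd] at hdisj
  refine Set.disjoint_left.1 hdisj ?_ (Set.mem_vadd_set.2 ⟨p, hp, rfl⟩)
  refine Set.mem_vadd_set.2 ⟨z - y + p, hpr ?_, ?_⟩
  · rw [mem_ball_iff_norm, add_sub_cancel_right, ← dist_eq_norm]
    exact hdist
  · simp only [vadd_eq_add]; abel

/-- In a tiling, every direction at a point is feasible for some tile that contains the point. -/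
theorem exists_tile_of_direction (hint : (interior P).Nonempty) (hc : IsCompact P)
    (hcov : (⋃ t ∈ T, (t +ᵥ P)) = Set.univ)
    (hT : T.PairwiseDisjoint fun t => interior (t +ᵥ P)) (x u : E) :
    ∃ t ∈ T, x ∈ t +ᵥ P ∧ ∃ ε : ℝ, 0 < ε ∧ x + ε • u ∈ t +ᵥ P := by
  have hfin := finite_setOf_tiles_meeting_closedBall hint hc.isBounded hT x
  set S := {t ∈ T | ((t +ᵥ P) ∩ Metric.closedBall x 1).Nonempty} with hS
  have htend : Filter.Tendsto (fun ε : ℝ => x + ε • u) (nhdsWithin 0 (Set.Ioi 0)) (nhds x) := by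
    have : Continuous fun ε : ℝ => x + ε • u := by fun_prop
    have h := this.tendsto 0
    simp only [zero_smul, add_zero] at h
    exact h.mono_left nhdsWithin_le_nhds
  have hev : ∀ᶠ ε in nhdsWithin (0 : ℝ) (Set.Ioi 0), ∃ t ∈ S, x + ε • u ∈ t +ᵥ P := by
    filter_upwards [htend (Metric.closedBall_mem_nhds x one_pos)] with ε hε
    have : x + ε • u ∈ ⋃ t ∈ T, (t +ᵥ P) := hcov ▸ Set.mem_univ _
    obtain ⟨t, ht, h⟩ := Set.mem_iUnion₂.1 this
    exact ⟨t, ⟨ht, _, h, hε⟩, h⟩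
  -- Only finitely many tiles are near `x`, so one of them contains `x + ε • u` for arbitrarily
  -- small `ε`; being closed, it also contains `x`.
  obtain ⟨t, ht, hfr⟩ : ∃ t ∈ S, ∃ᶠ ε in nhdsWithin (0 : ℝ) (Set.Ioi 0), x + ε • u ∈ t +ᵥ P := by
    by_contra! H
    have H' : ∀ᶠ ε in nhdsWithin (0 : ℝ) (Set.Ioi 0), ∀ t ∈ S, ¬ x + ε • u ∈ t +ᵥ P :=
      (Filter.eventually_all_finite hfin).2 fun t ht => by simpa using H t ht
    obtain ⟨ε, ⟨t, ht, h⟩, h'⟩ := (hev.and H').exists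
    exact h' t ht h
  refine ⟨t, ht.1, ?_, ?_⟩
  · exact (hc.vadd t).isClosed.mem_of_frequently_of_tendsto hfr htend
  · obtain ⟨ε, h, hε⟩ := (hfr.and_eventually self_mem_nhdsWithin).exists
    exact ⟨ε, hε, h⟩

/-- A relatively open subset of a translate of `L` contains a point at which all directions of `L`
are feasible for all tiles that contain the point. -/
theorem exists_generic_point (hint : (interior P).Nonempty) (hc : IsCompact P)
    (hT : T.PairwiseDisjoint fun t => interior (t +ᵥ P)) (L : Submodule ℝ E) (p : E)
    {O : Set L} (hO : IsOpen O) (hO0 : (0 : L) ∈ O) :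
    ∃ k ∈ O, ∀ t ∈ T, p + (k : E) ∈ t +ᵥ P →
      ∀ m ∈ L, ∃ ε : ℝ, 0 < ε ∧ p + (k : E) + ε • m ∈ t +ᵥ P := by
  have hfin := finite_setOf_tiles_meeting_closedBall hint hc.isBounded hT p
  set S := {t ∈ T | ((t +ᵥ P) ∩ Metric.closedBall p 1).Nonempty} with hS
  set K : E → Set L := fun t => {k : L | p + (k : E) ∈ t +ᵥ P} with hK
  have hcl : ∀ t, IsClosed (K t) := fun t => (hc.vadd t).isClosed.preimage (by fun_prop)
  -- Frontiers of closed sets are nowhere dense. Off all of them, each tile containing the point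
  -- contains a neighbourhood of it in the translate of `L`.
  have hdense : Dense (⋂ t ∈ S, (frontier (K t))ᶜ) := by
    refine dense_biInter_of_isOpen (fun t _ => isClosed_frontier.isOpen_compl) hfin.countable
      fun t _ => ?_
    rw [← interior_eq_empty_iff_dense_compl]
    exact interior_frontier (hcl t)
  obtain ⟨k, ⟨hkO, hk1⟩, hk⟩ := hdense.inter_open_nonempty
    (O ∩ Metric.ball 0 1) (hO.inter Metric.isOpen_ball) ⟨0, hO0, by simp⟩
  refine ⟨k, hkO, fun t ht hkt m hm => ?_⟩
  have htS : t ∈ S := by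
    refine ⟨ht, _, hkt, ?_⟩
    rw [mem_ball_zero_iff] at hk1
    rw [mem_closedBall_iff_norm, add_sub_cancel_left]
    exact hk1.le
  have hki : k ∈ interior (K t) := by
    have h1 : k ∉ frontier (K t) := Set.mem_iInter₂.1 hk t htS
    rw [(hcl t).frontier_eq] at h1
    by_contra h2
    exact h1 ⟨hkt, h2⟩
  have hcont : Continuous fun ε : ℝ => k + ε • (⟨m, hm⟩ : L) := by fun_prop
  have htend := hcont.tendsto 0
  simp only [zero_smul, add_zero] at htend
  have hev := (htend.eventually (mem_interior_iff_mem_nhds.1 hki)).filter_mono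
    (nhdsWithin_le_nhds (s := Set.Ioi 0))
  obtain ⟨ε, h, hε⟩ := (hev.and self_mem_nhdsWithin).exists
  refine ⟨ε, hε, ?_⟩
  have h' : p + ((k + ε • (⟨m, hm⟩ : L) : L) : E) ∈ t +ᵥ P := h
  simpa [add_assoc] using h'

-- The half-open segment from a point of a convex set to an interior point is interior. This lets
-- two tiles be compared at one common small step.
omit [FiniteDimensional ℝ E] in
theorem add_smul_mem_interior_of_le {Q : Set E} (hconv : Convex ℝ Q) {x u : E} {ε δ : ℝ}
    (hx : x ∈ Q) (h : x + ε • u ∈ interior Q) (hδ : 0 < δ) (hδε : δ ≤ ε) :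
    x + δ • u ∈ interior Q := by
  have hε : 0 < ε := hδ.trans_le hδε
  have := hconv.combo_interior_self_mem_interior h hx (div_pos hδ hε)
    (sub_nonneg.2 ((div_le_one hε).2 hδε)) (by ring)
  convert this using 1
  rw [smul_add, smul_smul, div_mul_cancel₀ _ hε.ne']
  module

omit [FiniteDimensional ℝ E] in
/-- Two tiles at a point do not have a common interior direction. -/
theorem eq_of_common_direction (hconv : Convex ℝ P)
    (hT : T.PairwiseDisjoint fun t => interior (t +ᵥ P)) {x u s t : E} (hs : s ∈ T) (ht : t ∈ T)
    (hxs : x ∈ s +ᵥ P) (hxt : x ∈ t +ᵥ P)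
    (hus : ∃ ε : ℝ, 0 < ε ∧ x + ε • u ∈ interior (s +ᵥ P))
    (hut : ∃ ε : ℝ, 0 < ε ∧ x + ε • u ∈ interior (t +ᵥ P)) : s = t := by
  obtain ⟨ε, hε, h1⟩ := hus
  obtain ⟨δ, hδ, h2⟩ := hut
  by_contra hne
  exact Set.disjoint_left.1 (hT hs ht hne)
    (add_smul_mem_interior_of_le (hconv.vadd s) hxs h1 (lt_min hε hδ) (min_le_left _ _))
    (add_smul_mem_interior_of_le (hconv.vadd t) hxt h2 (lt_min hε hδ) (min_le_right _ _))

omit [FiniteDimensional ℝ E] in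
/-- If all directions of `L` are feasible at a point of a convex body and a functional vanishing
on `L` is not extremal at that point, then the line that spans the kernel of the functional modulo
`L` contains an interior direction. -/
theorem exists_interior_direction {Q : Set E} (hconv : Convex ℝ Q) (hcl : IsClosed Q)
    (hint : (interior Q).Nonempty) {L : Submodule ℝ E} {φ : E →L[ℝ] ℝ} {s y : E}
    (hker : ∀ u, φ u = 0 → ∃ a : ℝ, u - a • s ∈ L)
    (hL : ∀ m ∈ L, ∃ ε : ℝ, 0 < ε ∧ y + ε • m ∈ Q)
    (hmax : ∃ z ∈ Q, φ y < φ z) (hmin : ∃ z ∈ Q, φ z < φ y) :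
    (∃ ε : ℝ, 0 < ε ∧ y + ε • s ∈ interior Q) ∨ ∃ ε : ℝ, 0 < ε ∧ y + ε • (-s) ∈ interior Q := by
  have hclos : closure (interior Q) = Q := by
    rw [hconv.closure_interior_eq_closure_of_nonempty_interior hint, hcl.closure_eq]
  have hI : ∀ O : Set ℝ, IsOpen O → (∃ z ∈ Q, φ z ∈ O) → ∃ z ∈ interior Q, φ z ∈ O := by
    rintro O hO ⟨z, hz, hzO⟩
    rw [← hclos] at hz
    obtain ⟨w, h1, h2⟩ := mem_closure_iff.1 hz _ (hO.preimage φ.continuous) hzO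
    exact ⟨w, h2, h1⟩
  obtain ⟨z1, hz1, h1⟩ := hI (Set.Ioi (φ y)) isOpen_Ioi hmax
  obtain ⟨z2, hz2, h2⟩ := hI (Set.Iio (φ y)) isOpen_Iio hmin
  rw [Set.mem_Ioi] at h1
  rw [Set.mem_Iio] at h2
  obtain ⟨z, hz, hzφ⟩ : ∃ z ∈ interior Q, φ z = φ y := by
    have hd : 0 < φ z1 - φ z2 := by linarith
    refine ⟨((φ y - φ z2) / (φ z1 - φ z2)) • z1 + ((φ z1 - φ y) / (φ z1 - φ z2)) • z2,
      hconv.interior hz1 hz2 (div_nonneg (by linarith) hd.le) (div_nonneg (by linarith) hd.le)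
        (by field_simp; ring), ?_⟩
    simp only [map_add, map_smul, smul_eq_mul]
    field_simp
    ring
  obtain ⟨a, ha⟩ := hker (z - y) (by rw [map_sub, hzφ, sub_self])
  obtain ⟨ε, hε, hk⟩ := hL _ (L.neg_mem ha)
  -- These weights on `z` and `y - ε • m`, where `m` is the `L`-part of `z - y`, make the
  -- `L`-components cancel.
  have hmem : y + (ε / (1 + ε) * a) • s ∈ interior Q := by
    have := hconv.combo_interior_self_mem_interior hz hk (a := ε / (1 + ε)) (b := 1 / (1 + ε))
      (by positivity) (by positivity) (by field_simp; ring)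
    convert this using 1
    rw [← sub_eq_zero]
    have e : (1 : ℝ) = ε / (1 + ε) + 1 / (1 + ε) := by field_simp; ring
    have e2 : ε / (1 + ε) = (1 / (1 + ε)) * ε := by ring
    have e3 : y = (ε / (1 + ε)) • y + (1 / (1 + ε)) • y := by rw [← add_smul, ← e, one_smul]
    nth_rw 1 [e3]
    rw [e2]
    module
  rcases lt_trichotomy a 0 with h | rfl | h
  · right
    refine ⟨ε / (1 + ε) * (-a), mul_pos (by positivity) (neg_pos.2 h), ?_⟩
    simpa using hmem
  · left
    simp only [mul_zero, zero_smul, add_zero] at hmem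
    have hcont : Continuous fun δ : ℝ => y + δ • s := by fun_prop
    have htend := hcont.tendsto 0
    simp only [zero_smul, add_zero] at htend
    have hev := (htend.eventually (isOpen_interior.mem_nhds hmem)).filter_mono
      (nhdsWithin_le_nhds (s := Set.Ioi 0))
    obtain ⟨δ, h, hδ⟩ := (hev.and self_mem_nhdsWithin).exists
    exact ⟨δ, hδ, h⟩
  · left
    exact ⟨ε / (1 + ε) * a, mul_pos (by positivity) h, hmem⟩

end Tiling

/-! ### Extremal functionals and coordinates modulo a ridge direction. -/

section Belt

variable {E : Type*} [NormedAddCommGroup E] [NormedSpace ℝ E] {n : ℕ} {v : Fin n → E} {c : E}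

/-- A functional is extremal over a set at a point if it attains its maximum or minimum there. -/
def IsExtremal (Q : Set E) (φ : E →ₗ[ℝ] ℝ) (y : E) : Prop :=
  (∀ z ∈ Q, φ z ≤ φ y) ∨ ∀ z ∈ Q, φ y ≤ φ z

theorem IsExtremal.weights {φ : E →ₗ[ℝ] ℝ} {w : Fin n → ℝ} (hw : ∀ i, 0 ≤ w i ∧ w i ≤ 1)
    (h : IsExtremal (c +ᵥ zonotope v) φ (c + ∑ i, w i • v i)) :
    (∀ i, (0 < φ (v i) → w i = 1) ∧ (φ (v i) < 0 → w i = 0)) ∨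
      ∀ i, (φ (v i) < 0 → w i = 1) ∧ (0 < φ (v i) → w i = 0) := by
  rcases h with h | h
  · exact Or.inl ((forall_le_iff_of_weights φ hw).1 h)
  · right
    have := (forall_le_iff_of_weights (c := c) (v := v) (-φ) hw).1 fun z hz => by
      simpa only [LinearMap.neg_apply, neg_le_neg_iff] using h z hz
    simpa using this

/-- Two functionals whose sign vectors on the generators are neither compatible nor opposite are
not extremal at the same point of the zonotope. -/
theorem IsExtremal.not_of_signs {φ ψ : E →ₗ[ℝ] ℝ} {y : E} (hy : y ∈ c +ᵥ zonotope v)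
    (hφ : IsExtremal (c +ᵥ zonotope v) φ y) (hn : ∃ i, φ (v i) * ψ (v i) < 0)
    (hp : ∃ i, 0 < φ (v i) * ψ (v i)) : ¬ IsExtremal (c +ᵥ zonotope v) ψ y := by
  intro hψ
  obtain ⟨w, hw, rfl⟩ := mem_vadd_zonotope.1 hy
  obtain ⟨i, hi⟩ := hn
  obtain ⟨k, hk⟩ := hp
  rw [mul_neg_iff] at hi
  rw [mul_pos_iff] at hk
  -- Generator `i`, with opposite signs, excludes two maxima or two minima; generator `k`, with
  -- equal signs, excludes a maximum together with a minimum.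
  rcases hφ.weights hw with h1 | h1 <;> rcases hψ.weights hw with h2 | h2
  · rcases hi with ⟨a, b⟩ | ⟨a, b⟩
    · linarith [(h1 i).1 a, (h2 i).2 b]
    · linarith [(h1 i).2 a, (h2 i).1 b]
  · rcases hk with ⟨a, b⟩ | ⟨a, b⟩
    · linarith [(h1 k).1 a, (h2 k).2 b]
    · linarith [(h1 k).2 a, (h2 k).1 b]
  · rcases hk with ⟨a, b⟩ | ⟨a, b⟩
    · linarith [(h1 k).2 a, (h2 k).1 b]
    · linarith [(h1 k).1 a, (h2 k).2 b]
  · rcases hi with ⟨a, b⟩ | ⟨a, b⟩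
    · linarith [(h1 i).2 a, (h2 i).1 b]
    · linarith [(h1 i).1 a, (h2 i).2 b]

theorem sub_mem_of_mem_maxFace {φ : E →ₗ[ℝ] ℝ} {L : Submodule ℝ E}
    (hφ : ∀ i, φ (v i) = 0 → v i ∈ L) {y z : E} (hy : y ∈ maxFace (c +ᵥ zonotope v) φ)
    (hz : z ∈ maxFace (c +ᵥ zonotope v) φ) : y - z ∈ L := by
  have h := vsub_mem_vectorSpan ℝ hy hz
  rw [vectorSpan_maxFace] at h
  exact flat_le_iff.2 hφ h

/-- At a point where `φ` is extremal no direction of the kernel of `φ` outside `L` is feasible. -/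
theorem IsExtremal.mem_of_feasible {φ : E →ₗ[ℝ] ℝ} {L : Submodule ℝ E}
    (hφ : ∀ i, φ (v i) = 0 → v i ∈ L) {y s : E} (hy : y ∈ c +ᵥ zonotope v)
    (h : IsExtremal (c +ᵥ zonotope v) φ y) (hs : φ s = 0)
    (hf : ∃ ε : ℝ, 0 < ε ∧ y + ε • s ∈ c +ᵥ zonotope v) : s ∈ L := by
  obtain ⟨ε, hε, hmem⟩ := hf
  have key : y + ε • s - y ∈ L := by
    rcases h with h | h
    · refine sub_mem_of_mem_maxFace hφ ⟨hmem, fun z hz => ?_⟩ ⟨hy, h⟩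
      simpa [hs] using h z hz
    · refine sub_mem_of_mem_maxFace (φ := -φ) (fun i hi => hφ i (by simpa using hi))
        ⟨hmem, fun z hz => ?_⟩ ⟨hy, fun z hz => ?_⟩
      · simpa [hs] using h z hz
      · simpa using h z hz
  rw [add_sub_cancel_left] at key
  exact (L.smul_mem_iff hε.ne').1 key

variable [FiniteDimensional ℝ E]

-- Generators in `L` have weight 1/2 at the barycentre, so these weights can move by less than 1/2
-- either way. The resulting displacements fill a neighbourhood of 0 because a surjective linear map
-- is open.
open Classical in
theorem exists_isOpen_subset_maxFace {φ : E →ₗ[ℝ] ℝ} {L : Submodule ℝ E}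
    (hL : flat v L = L) (hφL : ∀ u ∈ L, φ u = 0) :
    ∃ O : Set L, IsOpen O ∧ (0 : L) ∈ O ∧
      ∀ k ∈ O, c + ∑ i, faceWeight v φ i • v i + (k : E) ∈ maxFace (c +ᵥ zonotope v) φ := by
  let u : Fin n → L := fun i => if h : v i ∈ L then ⟨v i, h⟩ else 0
  have hu : ∀ i, (u i : E) = if v i ∈ L then v i else 0 := by
    intro i
    by_cases h : v i ∈ L <;> simp [u, h]
  let Λ : (Fin n → ℝ) →ₗ[ℝ] L := Fintype.linearCombination ℝ u
  have hsurj : Function.Surjective Λ := by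
    rw [← LinearMap.range_eq_top, Fintype.range_linearCombination]
    apply Submodule.map_injective_of_injective L.injective_subtype
    rw [Submodule.map_subtype_top, Submodule.map_span]
    apply le_antisymm
    · rw [Submodule.span_le]
      rintro _ ⟨x, -, rfl⟩
      exact x.2
    · nth_rw 1 [← hL]
      rw [flat_le_iff]
      intro i hi
      exact Submodule.subset_span ⟨u i, ⟨i, rfl⟩, by simp [hu, hi]⟩
  have hopen : IsOpenMap Λ := Λ.isOpenMap_of_finiteDimensional hsurj
  refine ⟨Λ '' Metric.ball 0 (1 / 2), hopen _ Metric.isOpen_ball,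
    ⟨0, by simp, map_zero _⟩, ?_⟩
  rintro _ ⟨w, hw, rfl⟩
  have hwi : ∀ i, |w i| < 1 / 2 := by
    intro i
    rw [mem_ball_zero_iff] at hw
    exact (norm_le_pi_norm w i).trans_lt hw
  refine mem_maxFace_iff.2
    ⟨fun i => faceWeight v φ i + if v i ∈ L then w i else 0, fun i => ?_, fun i => ?_, ?_⟩
  · by_cases h : v i ∈ L
    · have h0 := hφL _ h
      have := abs_lt.1 (hwi i)
      simp only [faceWeight, h0, h, lt_irrefl, if_true, if_false]
      constructor <;> linarith
    · simpa [h] using faceWeight_mem φ i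
  · by_cases h : v i ∈ L
    · have h0 := hφL _ h
      simp [h0]
    · simp only [h, if_false, add_zero]
      exact ⟨fun h => by simp [faceWeight, h],
        fun h => by simp [faceWeight, h, not_lt_of_gt h]⟩
  · rw [add_assoc]
    congr 1
    simp only [Λ, Fintype.linearCombination_apply, Submodule.coe_sum, Submodule.coe_smul, hu,
      ← Finset.sum_add_distrib]
    refine Finset.sum_congr rfl fun i _ => ?_
    by_cases h : v i ∈ L <;> simp [h, add_smul]

/-- Coordinates modulo a subspace of codimension two, the first of which does not vanish on the
generators outside the subspace. -/
theorem exists_coordinates {L : Submodule ℝ E}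
    (hdim : Module.finrank ℝ L + 2 = Module.finrank ℝ E) (hv : ∃ i, v i ∉ L) :
    ∃ α β : E →ₗ[ℝ] ℝ, (∀ u, u ∈ L ↔ α u = 0 ∧ β u = 0) ∧
      (∀ a b : ℝ, ∃ u, α u = a ∧ β u = b) ∧ ∀ i, v i ∉ L → α (v i) ≠ 0 := by
  -- Finitely many nonzero vectors of `E ⧸ L` can be avoided by the kernel of one functional.
  obtain ⟨α, hα⟩ := Module.exists_dual_forall_apply_ne_zero (K := ℝ)
    (fun i : {i // v i ∉ L} => L.mkQ (v i)) fun i => by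
      simpa using i.2
  obtain ⟨i₀, hi₀⟩ := hv
  set w₀ := L.mkQ (v i₀) with hw₀
  have h0 : α w₀ ≠ 0 := hα ⟨i₀, hi₀⟩
  have hα0 : α ≠ 0 := by
    rintro rfl
    simp at h0
  have hq : Module.finrank ℝ (E ⧸ L) = 2 := by
    have := Submodule.finrank_quotient_add_finrank L
    omega
  have hker : Module.finrank ℝ (LinearMap.ker α) = 1 := by
    have := Module.Dual.finrank_ker_add_one_of_ne_zero (f := α) hα0
    omega
  obtain ⟨w₁, hw₁, hspan⟩ := finrank_eq_one_iff'.1 hker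
  have hw₁' : (w₁ : E ⧸ L) ≠ 0 := by simpa using hw₁
  have hαw : α (w₁ : E ⧸ L) = 0 := w₁.2
  obtain ⟨β, hβ⟩ := Module.exists_dual_forall_apply_ne_zero (K := ℝ)
    (fun _ : Unit => (w₁ : E ⧸ L)) fun _ => hw₁'
  have hβ := hβ ()
  refine ⟨α.comp L.mkQ, β.comp L.mkQ, fun u => ?_, fun a b => ?_, fun i hi => hα ⟨i, hi⟩⟩
  · constructor
    · intro hu
      have : L.mkQ u = 0 := by simpa using hu
      simp [LinearMap.comp_apply, this]
    · rintro ⟨ha, hb⟩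
      simp only [LinearMap.comp_apply] at ha hb
      obtain ⟨r, hr⟩ := hspan ⟨L.mkQ u, ha⟩
      have hr' : r • (w₁ : E ⧸ L) = L.mkQ u := congrArg Subtype.val hr
      rw [← hr', map_smul, smul_eq_mul, mul_eq_zero] at hb
      have hr0 : r = 0 := hb.resolve_right hβ
      rw [hr0, zero_smul] at hr'
      simpa using hr'.symm
  · obtain ⟨u, hu⟩ := L.mkQ_surjective
      ((a / α w₀) • w₀ + ((b - a / α w₀ * β w₀) / β w₁) • (w₁ : E ⧸ L))
    refine ⟨u, ?_, ?_⟩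
    · rw [LinearMap.comp_apply, hu]
      simp [hαw, h0]
    · rw [LinearMap.comp_apply, hu]
      simp [hβ]

end Belt

/-! ### No four spanned hyperplanes through a common ridge direction. -/

section NoFour

variable {E : Type*} [NormedAddCommGroup E] [NormedSpace ℝ E] {n : ℕ} {v : Fin n → E} {c : E}

/-- A threshold below a real number that separates it from the smaller values of a finite family. -/
theorem exists_threshold {ι : Type*} [Finite ι] (a : ι → ℝ) (b : ℝ) :
    ∃ θ < b, ∀ i, a i < b → a i < θ := by
  have h : ∀ᶠ θ in nhdsWithin b (Set.Iio b), ∀ i, a i < b → a i < θ := by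
    rw [Filter.eventually_all]
    intro i
    by_cases hi : a i < b
    · filter_upwards [nhdsWithin_le_nhds (Ioi_mem_nhds hi)] with θ hθ _ using hθ
    · exact Filter.Eventually.of_forall fun _ h => absurd h hi
  obtain ⟨θ, h, hθ⟩ := (h.and self_mem_nhdsWithin).exists
  exact ⟨θ, hθ, h⟩

variable [FiniteDimensional ℝ E]

/-- Three tiles at a common point whose feasible directions contain `L`, and four functionals that
vanish on `L` and have pairwise incomparable sign vectors, cannot coexist. -/
theorem false_of_three_tiles {T : Set E} (hint : (interior (c +ᵥ zonotope v)).Nonempty)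
    (hT : T.PairwiseDisjoint fun t => interior (t +ᵥ (c +ᵥ zonotope v))) {L : Submodule ℝ E}
    {x : E} {τ : Fin 3 → E} (hτ : Function.Injective τ) (hτT : ∀ i, τ i ∈ T)
    (hx : ∀ i, x ∈ τ i +ᵥ (c +ᵥ zonotope v))
    (hfeas : ∀ i, ∀ m ∈ L, ∃ ε : ℝ, 0 < ε ∧ x + ε • m ∈ τ i +ᵥ (c +ᵥ zonotope v))
    {φ : Fin 4 → E →ₗ[ℝ] ℝ} {s : Fin 4 → E}
    (hker : ∀ j u, φ j u = 0 → ∃ a : ℝ, u - a • s j ∈ L)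
    (hn : ∀ j k, j ≠ k → ∃ i, φ j (v i) * φ k (v i) < 0)
    (hp : ∀ j k, ∃ i, 0 < φ j (v i) * φ k (v i)) : False := by
  simp only [vadd_vadd] at hT hx hfeas
  -- Otherwise the pigeonhole principle gives one tile over which two of the four functionals are
  -- extremal at `x`.
  obtain ⟨j, hj⟩ : ∃ j, ∀ i, ¬ IsExtremal ((τ i + c) +ᵥ zonotope v) (φ j) x := by
    by_contra! H
    choose f hf using H
    obtain ⟨j, k, hjk, h⟩ := Fintype.exists_ne_map_eq_of_card_lt f (by simp)
    exact (hf j).not_of_signs (hx _) (hn j k hjk) (hp j k) (h ▸ hf k)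
  have hdir : ∀ i, ∃ σ : Bool,
      ∃ ε : ℝ, 0 < ε ∧ x + ε • (if σ then s j else -s j) ∈ interior ((τ i + c) +ᵥ zonotope v) := by
    intro i
    have h := hj i
    simp only [IsExtremal, not_or, not_forall, not_le] at h
    obtain ⟨⟨z₁, hz₁, h₁⟩, z₂, hz₂, h₂⟩ := h
    have hint' : (interior ((τ i + c) +ᵥ zonotope v)).Nonempty := by
      rw [← vadd_vadd, interior_vadd]
      exact hint.image _
    rcases exists_interior_direction convex_vadd_zonotope isCompact_vadd_zonotope.isClosed hint'
      (φ := LinearMap.toContinuousLinearMap (φ j)) (hker j) (hfeas i)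
      ⟨z₁, hz₁, h₁⟩ ⟨z₂, hz₂, h₂⟩ with h | h
    · exact ⟨true, by simpa using h⟩
    · exact ⟨false, by simpa using h⟩
  choose σ hσ using hdir
  -- Three tiles, but only the two directions `s j` and `-s j`.
  obtain ⟨i, k, hik, h⟩ := Fintype.exists_ne_map_eq_of_card_lt σ (by simp)
  refine hik (hτ (eq_of_common_direction (P := c +ᵥ zonotope v) (x := x) convex_vadd_zonotope ?_
    (hτT i) (hτT k) ?_ ?_ (u := if σ i then s j else -s j) ?_ ?_))
  · simpa only [vadd_vadd, vadd_eq_add] using hT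
  · simpa only [vadd_vadd, vadd_eq_add] using hx i
  · simpa only [vadd_vadd, vadd_eq_add] using hx k
  · simpa only [vadd_vadd, vadd_eq_add] using hσ i
  · rw [h]
    simpa only [vadd_vadd, vadd_eq_add] using hσ k

/-- If the ridge directions `L` are feasible at a point of a ridge of a tile, then three tiles meet
at that point. -/
theorem exists_three_tiles {T : Set E} (hint : (interior (c +ᵥ zonotope v)).Nonempty)
    (hcov : (⋃ t ∈ T, (t +ᵥ (c +ᵥ zonotope v))) = Set.univ)
    (hT : T.PairwiseDisjoint fun t => interior (t +ᵥ (c +ᵥ zonotope v))) {L : Submodule ℝ E}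
    {x t₀ : E} (ht₀ : t₀ ∈ T) {φ : E →ₗ[ℝ] ℝ} {s : E}
    (hx : x ∈ maxFace ((t₀ + c) +ᵥ zonotope v) φ)
    (hfeas : ∀ t ∈ T, x ∈ t +ᵥ (c +ᵥ zonotope v) →
      ∀ m ∈ L, ∃ ε : ℝ, 0 < ε ∧ x + ε • m ∈ t +ᵥ (c +ᵥ zonotope v))
    (hφ : ∀ i, φ (v i) = 0 → v i ∈ L) (hs : φ s = 0) (hsL : s ∉ L)
    (hker : ∀ u, φ u = 0 → ∃ a : ℝ, u - a • s ∈ L) :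
    ∃ τ : Fin 3 → E, Function.Injective τ ∧ (∀ i, τ i ∈ T) ∧
      ∀ i, x ∈ τ i +ᵥ (c +ᵥ zonotope v) := by
  have hint' : ∀ t, (interior ((t + c) +ᵥ zonotope v)).Nonempty := by
    intro t
    rw [← vadd_vadd, interior_vadd]
    exact hint.image _
  obtain ⟨t₁, ht₁, hx₁, hε₁⟩ := exists_tile_of_direction hint isCompact_vadd_zonotope hcov hT x s
  obtain ⟨t₂, ht₂, hx₂, hε₂⟩ :=
    exists_tile_of_direction hint isCompact_vadd_zonotope hcov hT x (-s)
  have hx₀ : x ∈ t₀ +ᵥ (c +ᵥ zonotope v) := by simpa only [vadd_vadd, vadd_eq_add] using hx.1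
  have hnL : -s ∉ L := by simpa using hsL
  have hns : φ (-s) = 0 := by simp [hs]
  have h01 : t₀ ≠ t₁ := by
    rintro rfl
    simp only [vadd_vadd] at hε₁
    exact hsL (IsExtremal.mem_of_feasible hφ hx.1 (Or.inl hx.2) hs hε₁)
  have h02 : t₀ ≠ t₂ := by
    rintro rfl
    simp only [vadd_vadd] at hε₂
    exact hnL (IsExtremal.mem_of_feasible hφ hx.1 (Or.inl hx.2) hns hε₂)
  have h12 : t₁ ≠ t₂ := by
    rintro rfl
    have hfeas₁ := hfeas _ ht₁ hx₁
    have hnint : x ∉ interior (t₁ +ᵥ (c +ᵥ zonotope v)) := by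
      intro hxi
      obtain ⟨z, hz⟩ := hint' t₀
      have hev : ∀ᶠ δ in nhdsWithin (0 : ℝ) (Set.Ioi 0),
          x + δ • (z - x) ∈ interior (t₁ +ᵥ (c +ᵥ zonotope v)) := by
        have hcont : Continuous fun δ : ℝ => x + δ • (z - x) := by fun_prop
        have htend := hcont.tendsto 0
        simp only [zero_smul, add_zero] at htend
        exact (htend.eventually (isOpen_interior.mem_nhds hxi)).filter_mono nhdsWithin_le_nhds
      obtain ⟨δ, h, hδ⟩ := (hev.and self_mem_nhdsWithin).exists
      refine h01 (eq_of_common_direction convex_vadd_zonotope hT ht₀ ht₁ hx₀ hx₁ (u := z - x)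
        ⟨1, one_pos, ?_⟩ ⟨δ, hδ, h⟩)
      simpa only [vadd_vadd, vadd_eq_add, one_smul, add_sub_cancel] using hz
    -- An interior direction and a feasible opposite direction would place `x` inside the tile, by
    -- convexity.
    have hopp : ∀ u : E, (∃ ε : ℝ, 0 < ε ∧ x + ε • u ∈ interior (t₁ +ᵥ (c +ᵥ zonotope v))) →
        ¬ ∃ ε : ℝ, 0 < ε ∧ x + ε • (-u) ∈ t₁ +ᵥ (c +ᵥ zonotope v) := by
      rintro u ⟨ε, hε, h⟩ ⟨δ, hδ, h'⟩
      apply hnint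
      have := (convex_vadd_zonotope.vadd t₁).combo_interior_self_mem_interior h h'
        (a := δ / (ε + δ)) (b := ε / (ε + δ)) (by positivity) (by positivity)
        (by field_simp; ring)
      convert this using 1
      have e : (1 : ℝ) = δ / (ε + δ) + ε / (ε + δ) := by field_simp; ring
      have e2 : δ / (ε + δ) * ε = ε / (ε + δ) * δ := by ring
      have e3 : x = (δ / (ε + δ)) • x + (ε / (ε + δ)) • x := by rw [← add_smul, ← e, one_smul]
      rw [smul_add, smul_add, smul_smul, smul_smul, e2]
      nth_rw 1 [e3]
      module
    by_cases hext : IsExtremal ((t₁ + c) +ᵥ zonotope v) φ x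
    · simp only [vadd_vadd] at hε₁ hx₁
      exact hsL (hext.mem_of_feasible hφ hx₁ hs hε₁)
    · simp only [IsExtremal, not_or, not_forall, not_le] at hext
      obtain ⟨⟨z₁, hz₁, h₁⟩, z₂, hz₂, h₂⟩ := hext
      simp only [vadd_vadd] at hfeas₁ hopp hε₁ hε₂
      rcases exists_interior_direction convex_vadd_zonotope isCompact_vadd_zonotope.isClosed
        (hint' t₁) (φ := LinearMap.toContinuousLinearMap φ) hker hfeas₁
        ⟨z₁, hz₁, h₁⟩ ⟨z₂, hz₂, h₂⟩ with h | h
      · exact hopp _ h hε₂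
      · exact hopp _ h (by simpa using hε₁)
  refine ⟨![t₀, t₁, t₂], ?_, ?_, ?_⟩
  · intro i j
    fin_cases i <;> fin_cases j <;> simp [h01, h02, h12, h01.symm, h02.symm, h12.symm]
  · intro i
    fin_cases i <;> simp [ht₀, ht₁, ht₂]
  · intro i
    fin_cases i
    exacts [hx₀, hx₁, hx₂]

/-- In a space-filling zonotope at most three hyperplanes spanned by generators contain a given
subspace of codimension two that is spanned by generators. -/
theorem belt_card_le_three (hint : (interior (c +ᵥ zonotope v)).Nonempty)
    (htile : TilesByTranslates (c +ᵥ zonotope v)) {L : Submodule ℝ E} (hL : flat v L = L)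
    (hdim : Module.finrank ℝ L + 2 = Module.finrank ℝ E) (e : Fin 4 → Fin n)
    (he : ∀ j, v (e j) ∉ L) (hne : ∀ j k, j ≠ k → v (e j) ∉ L ⊔ Submodule.span ℝ {v (e k)}) :
    False := by
  obtain ⟨T, hcov, hT⟩ := htile
  obtain ⟨α, β, hαβ, hlift, hα⟩ := exists_coordinates hdim ⟨e 0, he 0⟩
  -- The slope of a generator modulo `L`. Generators in `L` get `0 / 0 = 0`, which only adds a
  -- harmless constraint on the thresholds below.
  set a : Fin n → ℝ := fun i => β (v i) / α (v i) with ha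
  have hinj : ∀ j k, j ≠ k → a (e j) ≠ a (e k) := by
    intro j k hjk h
    apply hne j k hjk
    have hj := hα _ (he j)
    have hk := hα _ (he k)
    have hmem : v (e j) - (α (v (e j)) / α (v (e k))) • v (e k) ∈ L := by
      rw [hαβ]
      constructor
      · simp [hk]
      · simp only [ha] at h
        rw [div_eq_div_iff hj hk] at h
        simp only [map_sub, map_smul, smul_eq_mul]
        field_simp
        linarith
    have := Submodule.add_mem_sup hmem (Submodule.smul_mem _ (α (v (e j)) / α (v (e k)))
      (Submodule.mem_span_singleton_self (R := ℝ) (v (e k))))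
    simpa using this
  -- Each `θ j` lies below the slope of `e j` and above all smaller slopes. Thus `β - θ j • α`
  -- vanishes on no generator outside `L`, and for two different slopes the larger threshold
  -- separates them.
  choose θ hθ hθ' using fun j => exists_threshold a (a (e j))
  set φ : Fin 4 → E →ₗ[ℝ] ℝ := fun j => β - θ j • α with hφdef
  have hφ : ∀ j u, φ j u = β u - θ j * α u := fun j u => rfl
  have hφv : ∀ j i, v i ∉ L → φ j (v i) = α (v i) * (a i - θ j) := by
    intro j i hi
    have := hα i hi
    rw [hφ]
    simp only [ha]
    field_simp
  choose s hsα hsβ using fun j => hlift 1 (θ j)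
  have hφs : ∀ j, φ j (s j) = 0 := by
    intro j
    rw [hφ, hsα, hsβ]
    ring
  have hφL : ∀ j, ∀ u ∈ L, φ j u = 0 := by
    intro j u hu
    obtain ⟨h1, h2⟩ := (hαβ u).1 hu
    rw [hφ, h1, h2]
    ring
  have hφ0 : ∀ j i, φ j (v i) = 0 → v i ∈ L := by
    intro j i h
    by_contra hi
    rw [hφv j i hi, mul_eq_zero] at h
    have h' := h.resolve_left (hα i hi)
    rcases lt_or_ge (a i) (a (e j)) with h1 | h1
    · linarith [hθ' j i h1]
    · linarith [hθ j]
  have hker : ∀ j u, φ j u = 0 → ∃ b : ℝ, u - b • s j ∈ L := by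
    intro j u hu
    refine ⟨α u, (hαβ _).2 ⟨?_, ?_⟩⟩
    · simp [hsα]
    · rw [hφ] at hu
      simp only [map_sub, map_smul, smul_eq_mul, hsβ]
      linarith
  have hn' : ∀ j k, a (e j) < a (e k) → φ j (v (e j)) * φ k (v (e j)) < 0 := by
    intro j k h
    rw [hφv _ _ (he j), hφv _ _ (he j)]
    have h1 := hθ j
    have h2 := hθ' k _ h
    have h3 := mul_self_pos.2 (hα _ (he j))
    have h4 : 0 < (a (e j) - θ j) * (θ k - a (e j)) := mul_pos (by linarith) (by linarith)
    nlinarith [mul_pos h3 h4]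
  have hn : ∀ j k, j ≠ k → ∃ i, φ j (v i) * φ k (v i) < 0 := by
    intro j k hjk
    rcases lt_or_gt_of_ne (hinj j k hjk) with h | h
    · exact ⟨_, hn' j k h⟩
    · exact ⟨_, by rw [mul_comm]; exact hn' k j h⟩
  -- The largest of the four slopes exceeds every threshold, so all four functionals have the same
  -- sign on `e m`.
  obtain ⟨m, hm⟩ := Finite.exists_max fun j => a (e j)
  have hp : ∀ j k, ∃ i, 0 < φ j (v i) * φ k (v i) := by
    intro j k
    refine ⟨e m, ?_⟩
    rw [hφv _ _ (he m), hφv _ _ (he m)]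
    have h1 := (hθ j).trans_le (hm j)
    have h2 := (hθ k).trans_le (hm k)
    have h3 := mul_self_pos.2 (hα _ (he m))
    have h4 : 0 < (a (e m) - θ j) * (a (e m) - θ k) := mul_pos (by linarith) (by linarith)
    nlinarith [mul_pos h3 h4]
  obtain ⟨t₀, ht₀⟩ : T.Nonempty := by
    have : (0 : E) ∈ ⋃ t ∈ T, (t +ᵥ (c +ᵥ zonotope v)) := hcov ▸ Set.mem_univ _
    obtain ⟨t, ht, -⟩ := Set.mem_iUnion₂.1 this
    exact ⟨t, ht⟩
  obtain ⟨O, hO, hO0, hOface⟩ := exists_isOpen_subset_maxFace (c := t₀ + c) hL (hφL 0)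
  obtain ⟨k, hkO, hfeas⟩ := exists_generic_point hint isCompact_vadd_zonotope hT L _ hO hO0
  have hsL : s 0 ∉ L := by
    intro h
    have := ((hαβ _).1 h).1
    rw [hsα] at this
    exact one_ne_zero this
  obtain ⟨τ, hτ, hτT, hτx⟩ := exists_three_tiles hint hcov hT ht₀ (hOface k hkO) hfeas (hφ0 0)
    (hφs 0) hsL (hker 0)
  exact false_of_three_tiles hint hT hτ hτT hτx (fun i => hfeas _ (hτT i) (hτx i)) hker hn hp

end NoFour

/-! ### Building belt paths. -/

section BeltPath

variable {E : Type*} [NormedAddCommGroup E] [NormedSpace ℝ E]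

theorem existsBeltPath_zero {P G : Set E} (hG : IsFacet P G) : ExistsBeltPath P G G 0 :=
  ⟨fun _ => G, Fin.elim0, ⟨fun _ => hG, fun i => i.elim0, fun i => i.elim0, fun i => i.elim0⟩,
    rfl, rfl⟩

theorem ExistsBeltPath.cons {P F F' G R : Set E} {m : ℕ} (hR : IsRidge P R) (hF : F ∈ belt P R)
    (hF' : F' ∈ belt P R) (h : ExistsBeltPath P F' G m) : ExistsBeltPath P F G (m + 1) := by
  obtain ⟨A, B, ⟨h1, h2, h3, h4⟩, rfl, rfl⟩ := h
  refine ⟨Fin.cons F A, Fin.cons (belt P R) B, ⟨?_, ?_, ?_, ?_⟩, rfl, ?_⟩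
  · intro i
    refine Fin.cases ?_ (fun i => ?_) i
    · exact hF.1
    · exact h1 i
  · intro i
    refine Fin.cases ?_ (fun i => ?_) i
    · exact ⟨R, hR, rfl⟩
    · exact h2 i
  · intro i
    refine Fin.cases ?_ (fun i => ?_) i
    · exact hF
    · simpa [← Fin.succ_castSucc] using h3 i
  · intro i
    refine Fin.cases ?_ (fun i => ?_) i
    · exact hF'
    · simpa using h4 i
  · rw [← Fin.succ_last, Fin.cons_succ]

theorem beltDist_le {P F G : Set E} {m k : ℕ} (h : ExistsBeltPath P F G m) (hm : m ≤ k) :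
    beltDist P F G ≤ k := by
  unfold beltDist
  split_ifs
  · exact zero_le
  · exact (iInf₂_le m h).trans (by exact_mod_cast hm)

end BeltPath

/-! ### Subspaces spanned by generators, and the halving argument. -/

section Flats

variable {E : Type*} [NormedAddCommGroup E] [NormedSpace ℝ E] {n : ℕ} {v : Fin n → E} {c : E}

theorem flat_sup_span {L : Submodule ℝ E} (hL : flat v L = L) (i : Fin n) :
    flat v (L ⊔ Submodule.span ℝ {v i}) = L ⊔ Submodule.span ℝ {v i} := by
  apply le_antisymm (flat_le _)
  rw [sup_le_iff, Submodule.span_singleton_le_iff_mem]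
  refine ⟨?_, mem_flat (Submodule.mem_sup_right (Submodule.mem_span_singleton_self _))⟩
  nth_rw 1 [← hL]
  exact flat_mono le_sup_left

variable [FiniteDimensional ℝ E]

theorem finrank_sup_span_singleton {L : Submodule ℝ E} {x : E} (hx : x ∉ L) :
    Module.finrank ℝ ↥(L ⊔ Submodule.span ℝ {x}) = Module.finrank ℝ L + 1 := by
  have h1 := Submodule.finrank_add_le_finrank_add_finrank L (Submodule.span ℝ {x})
  have h2 := finrank_span_singleton (K := ℝ) (v := x) (by rintro rfl; exact hx L.zero_mem)
  have h3 : L < L ⊔ Submodule.span ℝ {x} := by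
    refine lt_of_le_of_ne le_sup_left fun h => hx ?_
    rw [h]
    exact Submodule.mem_sup_right (Submodule.mem_span_singleton_self _)
  have := Submodule.finrank_lt_finrank_of_lt h3
  omega

/-- Every proper flat of a flat is contained in a flat of codimension one. -/
theorem exists_intermediate_flat {M H : Submodule ℝ E} (hM : flat v M = M) (hH : flat v H = H)
    (hMH : M < H) :
    ∃ L, flat v L = L ∧ M ≤ L ∧ L ≤ H ∧ Module.finrank ℝ L + 1 = Module.finrank ℝ H := by
  obtain ⟨L, ⟨hL, hML, hLH⟩, hmax⟩ := wellFounded_gt.has_min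
    {L : Submodule ℝ E | flat v L = L ∧ M ≤ L ∧ L < H} ⟨M, hM, le_rfl, hMH⟩
  obtain ⟨i, hiH, hiL⟩ : ∃ i, v i ∈ H ∧ v i ∉ L := by
    by_contra! h
    rw [← flat_le_iff, hH] at h
    exact hLH.not_ge h
  have hle : L ⊔ Submodule.span ℝ {v i} ≤ H :=
    sup_le hLH.le ((Submodule.span_singleton_le_iff_mem _ _).2 hiH)
  have hmem : v i ∈ L ⊔ Submodule.span ℝ {v i} :=
    Submodule.mem_sup_right (Submodule.mem_span_singleton_self _)
  have heq : L ⊔ Submodule.span ℝ {v i} = H := by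
    by_contra hne
    exact hmax _ ⟨flat_sup_span hL i, hML.trans le_sup_left, lt_of_le_of_ne hle hne⟩
      (lt_of_le_of_ne le_sup_left fun h => hiL (h ▸ hmem))
  exact ⟨L, hL, hML, hLH.le, by rw [← heq, finrank_sup_span_singleton hiL]⟩

/-- The vector span of a facet is a hyperplane spanned by generators. -/
theorem IsFacet.flat_vectorSpan {F : Set E} (hint : (interior (c +ᵥ zonotope v)).Nonempty)
    (hF : IsFacet (c +ᵥ zonotope v) F) : flat v (vectorSpan ℝ F) = vectorSpan ℝ F := by
  obtain ⟨l, -, rfl, h⟩ := (isFacet_iff hint).1 hF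
  rw [vectorSpan_maxFace, h, h]

omit [FiniteDimensional ℝ E] in
theorem IsFacet.finrank_vectorSpan {F : Set E} (hint : (interior (c +ᵥ zonotope v)).Nonempty)
    (hF : IsFacet (c +ᵥ zonotope v) F) :
    Module.finrank ℝ (vectorSpan ℝ F) + 1 = Module.finrank ℝ E := by
  rw [← dim_of_interior_nonempty hint]
  exact hF.2

/-- Every hyperplane spanned by generators is the vector span of a facet. -/
theorem exists_facet_of_flat (hint : (interior (c +ᵥ zonotope v)).Nonempty) {A : Submodule ℝ E}
    (hA : flat v A = A) (hdim : Module.finrank ℝ A + 1 = Module.finrank ℝ E) :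
    ∃ F, IsFacet (c +ᵥ zonotope v) F ∧ vectorSpan ℝ F = A := by
  have hlt : A < ⊤ := by
    rw [lt_top_iff_ne_top]
    rintro rfl
    rw [finrank_top] at hdim
    omega
  obtain ⟨l, hl, hle⟩ := Submodule.exists_le_ker_of_lt_top A hlt
  have hk : A = LinearMap.ker l := by
    apply Submodule.eq_of_le_of_finrank_eq hle
    have := Module.Dual.finrank_ker_add_one_of_ne_zero (f := l) hl
    omega
  subst hk
  exact ⟨_, (isFacet_iff hint).2 ⟨l, hl, rfl, hA⟩, by rw [vectorSpan_maxFace, hA]⟩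

/-- Every subspace of codimension two spanned by generators is the vector span of a ridge. -/
theorem exists_ridge_of_flat (hint : (interior (c +ᵥ zonotope v)).Nonempty) {L : Submodule ℝ E}
    (hL : flat v L = L) (hdim : Module.finrank ℝ L + 2 = Module.finrank ℝ E)
    (hv : ∃ i, v i ∉ L) :
    ∃ R, IsRidge (c +ᵥ zonotope v) R ∧ vectorSpan ℝ R = L := by
  obtain ⟨α, β, hαβ, -, hα⟩ := exists_coordinates hdim hv
  have h : vectorSpan ℝ (maxFace (c +ᵥ zonotope v) α) = L := by
    rw [vectorSpan_maxFace]
    apply le_antisymm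
    · exact flat_le_iff.2 fun i hi => by_contra fun h => hα i h hi
    · nth_rw 1 [← hL]
      exact flat_mono fun u hu => ((hαβ u).1 hu).1
  exact ⟨_, ⟨isFace_maxFace α, by rw [dim, h, dim_of_interior_nonempty hint, hdim]⟩, h⟩

/-- A form of `belt_card_le_three` with an asymmetric hypothesis. -/
theorem belt_card_le_three' (hint : (interior (c +ᵥ zonotope v)).Nonempty)
    (htile : TilesByTranslates (c +ᵥ zonotope v)) {L : Submodule ℝ E} (hL : flat v L = L)
    (hdim : Module.finrank ℝ L + 2 = Module.finrank ℝ E) (e : Fin 4 → Fin n)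
    (he : ∀ j, v (e j) ∉ L) (hne : ∀ j k, j < k → v (e k) ∉ L ⊔ Submodule.span ℝ {v (e j)}) :
    False := by
  refine belt_card_le_three hint htile hL hdim e he fun j k hjk h => ?_
  rcases lt_or_gt_of_ne hjk with hlt | hlt
  · apply hne j k hlt
    have heq : L ⊔ Submodule.span ℝ {v (e j)} = L ⊔ Submodule.span ℝ {v (e k)} := by
      apply Submodule.eq_of_le_of_finrank_eq
      · exact sup_le le_sup_left ((Submodule.span_singleton_le_iff_mem _ _).2 h)
      · rw [finrank_sup_span_singleton (he j), finrank_sup_span_singleton (he k)]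
    rw [heq]
    exact Submodule.mem_sup_right (Submodule.mem_span_singleton_self _)
  · exact hne k j hlt h

/-- If `L` is a flat of codimension one in a hyperplane `H`, and `K` is a hyperplane such that all
generators in `H ∩ K` belong to `L`, then some hyperplane through `L` halves the codimension of the
common flat with `K`. -/
theorem exists_hyperplane_halving (hint : (interior (c +ᵥ zonotope v)).Nonempty)
    (htile : TilesByTranslates (c +ᵥ zonotope v)) {H K L : Submodule ℝ E} (hH : flat v H = H)
    (hK : flat v K = K) (hL : flat v L = L) (hML : flat v (H ⊓ K) ≤ L) (hLH : L ≤ H)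
    (hHdim : Module.finrank ℝ H + 1 = Module.finrank ℝ E)
    (hKdim : Module.finrank ℝ K + 1 = Module.finrank ℝ E)
    (hLdim : Module.finrank ℝ L + 2 = Module.finrank ℝ E) {N : ℕ} (hN : 1 ≤ N)
    (hMN : Module.finrank ℝ E ≤ Module.finrank ℝ (flat v (H ⊓ K)) + 2 * N) :
    ∃ A, flat v A = A ∧ L ≤ A ∧ Module.finrank ℝ A + 1 = Module.finrank ℝ E ∧
      Module.finrank ℝ E ≤ Module.finrank ℝ (flat v (A ⊓ K)) + N := by
  have hnot : ∀ H : Submodule ℝ E, flat v H = H → Module.finrank ℝ H + 1 = Module.finrank ℝ E →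
      ∃ i, v i ∈ H ∧ v i ∉ L := by
    intro H hH hHdim
    by_contra! h
    rw [← flat_le_iff, hH] at h
    have := Submodule.finrank_mono h
    omega
  have hspan : ∀ i, v i ∉ L →
      Module.finrank ℝ ↥(L ⊔ Submodule.span ℝ {v i}) + 1 = Module.finrank ℝ E := by
    intro i hi
    rw [finrank_sup_span_singleton hi]
    omega
  have hKH : ∀ i, v i ∈ K → v i ∉ L → v i ∉ H :=
    fun i hi hiL hiH => hiL (hML (mem_flat ⟨hiH, hi⟩))
  obtain ⟨i₀, hi₀H, hi₀L⟩ := hnot H hH hHdim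
  obtain ⟨i₁, hi₁K, hi₁L⟩ := hnot K hK hKdim
  have hH₀ : L ⊔ Submodule.span ℝ {v i₀} ≤ H :=
    sup_le hLH ((Submodule.span_singleton_le_iff_mem _ _).2 hi₀H)
  set A := L ⊔ Submodule.span ℝ {v i₁} with hA
  by_cases hall : ∀ i, v i ∈ K → v i ∈ A
  · refine ⟨A, flat_sup_span hL i₁, le_sup_left, hspan _ hi₁L, ?_⟩
    have hKA : K ≤ A := by
      rw [← flat_le_iff, hK] at hall
      exact hall
    rw [inf_eq_right.2 hKA, hK]
    omega
  push Not at hall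
  obtain ⟨i₂, hi₂K, hi₂A⟩ := hall
  have hi₂L : v i₂ ∉ L := fun h => hi₂A (le_sup_left (a := L) h)
  set B := L ⊔ Submodule.span ℝ {v i₂} with hB
  -- A generator in `K` off both `A` and `B` would give a fourth hyperplane through `L`, besides
  -- `A`, `B` and `H` (spanned by `L` and `v i₀`).
  have hAB : ∀ i, v i ∈ K → v i ∈ A ∨ v i ∈ B := by
    intro i₃ hi₃K
    by_contra! h
    obtain ⟨h1, h2⟩ := h
    have hi₃L : v i₃ ∉ L := fun h => h1 (le_sup_left (a := L) h)
    refine belt_card_le_three' hint htile hL hLdim ![i₀, i₁, i₂, i₃] ?_ ?_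
    · intro j
      fin_cases j
      exacts [hi₀L, hi₁L, hi₂L, hi₃L]
    · intro j k hjk
      fin_cases j <;> fin_cases k <;> first | exact absurd hjk (by decide) | skip
      · exact fun h => hKH _ hi₁K hi₁L (hH₀ h)
      · exact fun h => hKH _ hi₂K hi₂L (hH₀ h)
      · exact fun h => hKH _ hi₃K hi₃L (hH₀ h)
      · exact hi₂A
      · exact h1
      · exact h2
  have hM : ∀ X : Submodule ℝ E, L ≤ X → flat v (H ⊓ K) ≤ flat v (X ⊓ K) := by
    intro X hX
    rw [← flat_flat]
    exact flat_mono (le_inf (hML.trans hX) ((flat_le _).trans inf_le_right))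
  have hsup : K ≤ flat v (A ⊓ K) ⊔ flat v (B ⊓ K) := by
    nth_rw 1 [← hK]
    refine flat_le_iff.2 fun i hi => ?_
    rcases hAB i hi with h | h
    · exact Submodule.mem_sup_left (mem_flat ⟨h, hi⟩)
    · exact Submodule.mem_sup_right (mem_flat ⟨h, hi⟩)
  have h1 := Submodule.finrank_mono hsup
  have h2 := Submodule.finrank_mono
    (le_inf (hM A (le_sup_left (a := L))) (hM B (le_sup_left (a := L))))
  have h3 := Submodule.finrank_sup_add_finrank_inf_eq (flat v (A ⊓ K)) (flat v (B ⊓ K))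
  rcases le_or_gt (Module.finrank ℝ E) (Module.finrank ℝ (flat v (A ⊓ K)) + N) with h | h
  · exact ⟨A, flat_sup_span hL i₁, le_sup_left, hspan _ hi₁L, h⟩
  -- With `d = dim E`, the two dimensions add up to at least `(d - 1) + (d - 2 * N)`; if the first
  -- is at most `d - N - 1`, the second is at least `d - N`.
  · exact ⟨B, flat_sup_span hL i₂, le_sup_left, hspan _ hi₂L, by omega⟩

/-- Two facets whose common flat has codimension at most `2 ^ k` are parallel or joined by a belt
path of length at most `k`. -/
theorem parallel_or_existsBeltPath (hint : (interior (c +ᵥ zonotope v)).Nonempty)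
    (htile : TilesByTranslates (c +ᵥ zonotope v)) (k : ℕ) {F G : Set E}
    (hF : IsFacet (c +ᵥ zonotope v) F) (hG : IsFacet (c +ᵥ zonotope v) G)
    (h : Module.finrank ℝ E ≤
      Module.finrank ℝ (flat v (vectorSpan ℝ F ⊓ vectorSpan ℝ G)) + 2 ^ k) :
    vectorSpan ℝ F = vectorSpan ℝ G ∨ ∃ m ≤ k, ExistsBeltPath (c +ᵥ zonotope v) F G m := by
  have hGdim := hG.finrank_vectorSpan hint
  induction k generalizing F with
  | zero =>
    left
    have hFdim := hF.finrank_vectorSpan hint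
    have h1 := (flat_le (v := v) (vectorSpan ℝ F ⊓ vectorSpan ℝ G)).trans inf_le_left
    have h2 := (flat_le (v := v) (vectorSpan ℝ F ⊓ vectorSpan ℝ G)).trans inf_le_right
    have h3 := Submodule.eq_of_le_of_finrank_le h1 (by omega)
    have h4 := Submodule.eq_of_le_of_finrank_le h2 (by omega)
    exact h3.symm.trans h4
  | succ k ih =>
    by_cases hFG : vectorSpan ℝ F = vectorSpan ℝ G
    · exact Or.inl hFG
    right
    have hFdim := hF.finrank_vectorSpan hint
    have hFflat := hF.flat_vectorSpan hint
    have hGflat := hG.flat_vectorSpan hint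
    obtain ⟨L, hL, hML, hLF, hLdim⟩ := exists_intermediate_flat (flat_flat (v := v) _) hFflat
      (lt_of_le_of_ne ((flat_le (v := v) (vectorSpan ℝ F ⊓ vectorSpan ℝ G)).trans inf_le_left) (by
        intro heq
        have : vectorSpan ℝ F ≤ vectorSpan ℝ G := by
          rw [← heq]
          exact (flat_le _).trans inf_le_right
        exact hFG (Submodule.eq_of_le_of_finrank_eq this (by omega))))
    have hLdim' : Module.finrank ℝ L + 2 = Module.finrank ℝ E := by omega
    obtain ⟨A, hA, hLA, hAdim, hAG⟩ := exists_hyperplane_halving hint htile hFflat hGflat hL hML hLF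
      hFdim hGdim hLdim' (Nat.one_le_two_pow (n := k)) (by rwa [← pow_succ'])
    obtain ⟨F', hF', rfl⟩ := exists_facet_of_flat hint hA hAdim
    obtain ⟨R, hR, rfl⟩ := exists_ridge_of_flat hint hL hLdim' (by
      by_contra! hv
      have := flat_le_iff.2 fun i (_ : v i ∈ vectorSpan ℝ F) => hv i
      rw [hFflat] at this
      have := Submodule.finrank_mono this
      omega)
    rcases ih hF' hAG with heq | ⟨m, hm, hpath⟩
    -- Here `F'` is parallel to `G`, so `G` itself lies in the belt of `R` and `F'` is skipped.
    · exact ⟨1, by omega, (existsBeltPath_zero hG).cons hR ⟨hF, hLF⟩ ⟨hG, heq ▸ hLA⟩⟩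
    · exact ⟨m + 1, by omega, hpath.cons hR ⟨hF, hLF⟩ ⟨hF', hLA⟩⟩

/-- A space-filling zonotope of dimension at most `2 ^ k` has belt diameter at most `k`. -/
theorem beltDiameter_zonotope_le (hint : (interior (c +ᵥ zonotope v)).Nonempty)
    (htile : TilesByTranslates (c +ᵥ zonotope v)) {k : ℕ} (hk : Module.finrank ℝ E ≤ 2 ^ k) :
    beltDiameter (c +ᵥ zonotope v) ≤ k := by
  refine iSup₂_le fun F hF => iSup₂_le fun G hG => ?_
  -- The common flat may be zero, so its codimension is bounded only by `finrank ℝ E ≤ 2 ^ k`.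
  rcases parallel_or_existsBeltPath hint htile k hF hG (by omega) with h | ⟨m, hm, h⟩
  · rcases eq_or_areOpposite hint hF hG h with rfl | h
    · exact beltDist_le (existsBeltPath_zero hF) (Nat.zero_le k)
    · simp [beltDist, h]
  · exact beltDist_le h hm

end Flats

end SpaceFilling

theorem mainTheorem2 (d : ℕ) (hd : 1 ≤ d) (P : Set (EuclideanSpace ℝ (Fin d)))
    (hZ : SpaceFilling.IsZonotope P) (hP : SpaceFilling.IsParallelohedron P) :
    SpaceFilling.beltDiameter P ≤ ((⌈Real.logb 2 (d : ℝ)⌉₊ : ℕ) : ℕ∞) := by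
  obtain ⟨n, v, c, rfl⟩ := hZ
  refine SpaceFilling.beltDiameter_zonotope_le hP.interior_nonempty hP.tiles ?_
  rw [finrank_euclideanSpace_fin]
  have h := Nat.le_ceil (Real.logb 2 (d : ℝ))
  rw [Real.logb_le_iff_le_rpow one_lt_two (by exact_mod_cast hd), Real.rpow_natCast] at h
  exact_mod_cast h
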